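/- Let $(R,\mathfrak m)$ be a commutative Noetherian local ring with $\dim R=1$, and let $M$ be a finitely generated $R$-module with rank, i.e. there is an integer $r\ge 0$ such that $M_{\mathfrak p}$ is a free $R_{\mathfrak p}$-module of rank $r$ for every associated prime $\mathfrak p$ of $R$. Assume that $r>0$ or $M=0$. Put $M^*=\operatorname{Hom}_R(M,R)$, let $\operatorname{tr}_R(M)\subseteq R$ be the image of the map $M^*\otimes_R M\to R$, $f\otimes x\mapsto f(x)$, and assume that $M\otimes_R M^*$ is torsionfree, i.e. no regular element (nonzerodivisor) of $R$ kills a nonzero element of $M\otimes_R M^*$. 1. If there exist an element $x\in R$ and an integer $n\ge 0$ such that $\operatorname{tr}_R(M)\subseteq\mathfrak m^n$ and $x\,\mathfrak m^n=\mathfrak m^{n+1}$, then $M$ is free. 2. In particular, if $R$ has minimal multiplicity, i.e. $e(R)=\operatorname{embdim}R-\dim R+1$, then $M$ is free. (Here $e(R)=\lim_{n\to\infty}\lambda(R/\mathfrak m^n)/n$, with $\lambda$ the length, is the multiplicity of the one-dimensional ring $R$, and $\operatorname{embdim}R=\dim_{R/\mathfrak m}\mathfrak m/\mathfrak m^2$.)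 -/

import Mathlib

open Filter Topology
open scoped TensorProduct Nat

/-- `M` has rank `r`: for every associated prime `p` of the ring `R`, the localization `M_p`
is a free `R_p`-module of rank `r`. -/
def HasModuleRank (R : Type*) [CommRing R] (M : Type*) [AddCommGroup M] [Module R M]
    (r : ℕ) : Prop :=
  ∀ (p : Ideal R) [p.IsPrime], p ∈ associatedPrimes R R →
    Module.Free (Localization.AtPrime p) (LocalizedModule p.primeCompl M) ∧
      Module.finrank (Localization.AtPrime p) (LocalizedModule p.primeCompl M) = r

/-- The trace ideal of `M`: the image of the evaluation map `M* ⊗ M → R`, `f ⊗ x ↦ f x`. -/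
noncomputable def traceIdeal (R : Type*) [CommRing R] (M : Type*) [AddCommGroup M]
    [Module R M] : Ideal R :=
  LinearMap.range (contractLeft R M)

/-- The Hilbert–Samuel function `n ↦ λ(R / 𝔪 ^ n)` of a local ring. The length is finite when
`R` is Noetherian, so that `ENat.toNat` loses nothing there. -/
noncomputable def hilbertSamuel (R : Type*) [CommRing R] [IsLocalRing R] (n : ℕ) : ℕ :=
  (Module.length R (R ⧸ IsLocalRing.maximalIdeal R ^ n)).toNat

/-- `e` is the multiplicity of the local ring `R`: for `d = dim R`,
`e = lim d! * λ(R / 𝔪 ^ n) / n ^ d`. -/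
def HasMultiplicity (R : Type*) [CommRing R] [IsLocalRing R] (e : ℕ) : Prop :=
  ∃ d : ℕ, ringKrullDim R = d ∧
    Tendsto (fun n : ℕ => ((d ! : ℕ) : ℝ) * (hilbertSamuel R n : ℝ) / (n : ℝ) ^ d)
      atTop (𝓝 (e : ℝ))

/-- The embedding dimension `dim_k (𝔪 / 𝔪 ^ 2)` of a local ring. -/
noncomputable def embDim (R : Type*) [CommRing R] [IsLocalRing R] : ℕ :=
  Module.finrank (IsLocalRing.ResidueField R) (IsLocalRing.CotangentSpace R)

/-- `R` has minimal multiplicity: `e(R) = embdim R - dim R + 1` (for Cohen–Macaulay `R`, equality in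
Abhyankar's inequality). -/
def HasMinimalMultiplicity (R : Type*) [CommRing R] [IsLocalRing R] : Prop :=
  ∃ d e : ℕ, ringKrullDim R = d ∧ HasMultiplicity R e ∧ e + d = embDim R + 1

/-!
If `x 𝔪ⁿ = 𝔪ⁿ⁺¹` and `tr(M) ⊆ 𝔪ⁿ`, then multiplication by `x` on `M* = Hom(M, R)` has a cokernel `C`
killed by `𝔪`: for `a ∈ 𝔪` and `f ∈ M*` the values of `a f` lie in `𝔪ⁿ⁺¹ = x 𝔪ⁿ`. Since `M` is
generically free of rank `r` and `M ⊗ M*` is torsionfree, multiplication by `x` on `M ⊗ M*` has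
cokernel of length `r · ℓ(C)`. On the other hand this cokernel is `M ⊗ C`, of length `μ(M) · ℓ(C)`,
where `μ(M)` is the minimal number of generators. Hence `μ(M) = r`, and `M`, being torsionfree, is
free. The same argument works with `Hom(M, A)` for a finite free extension `A` of `R`.

In minimal multiplicity, such an `x` for `n = 1` exists over a suitable `A`: a polynomial with
content ideal `𝔪` plays the role of a generic element of `𝔪`. By the Dedekind–Mertens formula and
the Ratliff–Rush property of high powers of `𝔪`, multiplication by it is injective from
`𝔪ⁿ[X] / 𝔪ⁿ⁺¹[X]` to `𝔪ⁿ⁺¹[X] / 𝔪ⁿ⁺²[X]` for large `n`, so `μ(𝔪ⁿ)` is eventually monotone, hence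
equal to `e(R) = μ(𝔪)` for some `n` and `n + 1`; comparing lengths then gives `x 𝔪 A = 𝔪² A`.
-/

section Length

variable {R : Type*} [CommRing R] {M N P : Type*} [AddCommGroup M] [AddCommGroup N]
  [AddCommGroup P] [Module R M] [Module R N] [Module R P]

/-- The length of the cokernel of a linear map; it plays the role of the valuation of the
determinant of an endomorphism. -/
noncomputable def cokerLength (f : M →ₗ[R] N) : ℕ∞ :=
  Module.length R (N ⧸ LinearMap.range f)

theorem cokerLength_comp (f : M →ₗ[R] N) (g : N →ₗ[R] P) (hg : Function.Injective g) :
    cokerLength (g ∘ₗ f) = cokerLength f + cokerLength g := by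
  have hle : LinearMap.range (g ∘ₗ f) ≤ LinearMap.range g := LinearMap.range_comp_le_range f g
  have hcomap : LinearMap.range f = (LinearMap.range (g ∘ₗ f)).comap g := by
    rw [LinearMap.range_comp, Submodule.comap_map_eq_of_injective hg]
  refine Module.length_eq_add_of_exact (Submodule.mapQ _ _ g hcomap.le) (Submodule.factor hle) ?_
    (Submodule.factor_surjective hle) ?_
  · rw [← LinearMap.ker_eq_bot, Submodule.mapQ, Submodule.ker_liftQ_eq_bot']
    rw [LinearMap.ker_comp, Submodule.ker_mkQ, hcomap]
  · rw [LinearMap.exact_iff, Submodule.factor, Submodule.ker_mapQ, Submodule.range_mapQ,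
      Submodule.comap_id]

theorem cokerLength_eq_zero_iff (f : M →ₗ[R] N) :
    cokerLength f = 0 ↔ Function.Surjective f := by
  rw [cokerLength, Module.length_eq_zero_iff, Submodule.Quotient.subsingleton_iff,
    LinearMap.range_eq_top]

theorem cokerLength_eq_of_comp_eq (α : M →ₗ[R] N) (hα : Function.Injective α)
    (hα_coker : cokerLength α ≠ ⊤) {f : M →ₗ[R] M} {g : N →ₗ[R] N} (hg : Function.Injective g)
    (h : α ∘ₗ f = g ∘ₗ α) : cokerLength f = cokerLength g := by
  have hsum := cokerLength_comp f α hα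
  rw [h, cokerLength_comp α g hg, add_comm] at hsum
  exact (ENat.add_left_injective_of_ne_top hα_coker hsum).symm

theorem cokerLength_lTensor (f : N →ₗ[R] P) :
    cokerLength (f.lTensor M) = Module.length R (M ⊗[R] (P ⧸ LinearMap.range f)) :=
  (lTensor.equiv M (LinearMap.exact_map_mkQ_range f) (Submodule.mkQ_surjective _)).length_eq

theorem cokerLength_lTensor_pi (r : ℕ) (f : N →ₗ[R] P) :
    cokerLength (f.lTensor (Fin r → R)) = r * cokerLength f := by
  rw [cokerLength_lTensor, ((TensorProduct.comm R (Fin r → R) _).trans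
    (TensorProduct.piScalarRight R R _ (Fin r))).length_eq, Module.length_pi, cokerLength]
  simp

theorem length_ne_top_of_smul_eq_zero [IsNoetherianRing R] [Ring.KrullDimLE 1 R]
    [Module.Finite R M] {c : R} (hc : IsRegular c) (h : ∀ x : M, c • x = 0) :
    Module.length R M ≠ ⊤ := by
  have : IsArtinian R (R ⧸ Ideal.span {c}) := (isFiniteLength_iff_isNoetherian_isArtinian.mp
    (isFiniteLength_quotient_span_singleton R hc.mem_nonZeroDivisors)).2
  have : IsArtinianRing (R ⧸ Ideal.span {c}) := isArtinian_of_tower R this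
  have htors : Module.IsTorsionBySet R M (Ideal.span {c} : Ideal R) :=
    (Module.isTorsionBySet_span_singleton_iff c).mpr fun x => h x
  let _ : Module (R ⧸ Ideal.span {c}) M := htors.module
  have : IsScalarTower R (R ⧸ Ideal.span {c}) M := htors.isScalarTower
  have : Module.Finite (R ⧸ Ideal.span {c}) M := Module.Finite.of_restrictScalars_finite R _ M
  have : IsArtinian R M := isArtinian_of_surjective_algebraMap
    (Ideal.Quotient.mk_surjective (I := Ideal.span {c}))
  exact Module.length_ne_top

end Length

section MinimalGenerators

open IsLocalRing

/-- The minimal number of generators of a finitely generated module over a local ring, encoded as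
the dimension of its reduction modulo the maximal ideal. -/
noncomputable def minGenerators (R M : Type*) [CommRing R] [IsLocalRing R] [AddCommGroup M]
    [Module R M] : ℕ :=
  Module.finrank (ResidueField R) (ResidueField R ⊗[R] M)

variable {R : Type*} [CommRing R] [IsLocalRing R] {M N : Type*} [AddCommGroup M]
  [AddCommGroup N] [Module R M] [Module R N] [Module.Finite R M]

theorem exists_minimal_generators :
    ∃ v : Fin (minGenerators R M) → M, Submodule.span R (Set.range v) = ⊤ ∧
      ∀ w : Fin (minGenerators R M) → R,
        ∑ i, w i • v i ∈ maximalIdeal R • (⊤ : Submodule R M) →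
        ∀ i, w i ∈ maximalIdeal R := by
  let b : Module.Basis (Fin (minGenerators R M)) _ _ :=
    Module.finBasis (ResidueField R) (ResidueField R ⊗[R] M)
  obtain ⟨v, hv⟩ := (TensorProduct.mk_surjective R M (ResidueField R)
    residue_surjective).comp_left b
  have hvb : ∀ i, (1 : ResidueField R) ⊗ₜ[R] v i = b i := congrFun hv
  refine ⟨v, span_eq_top_of_tmul_eq_basis v b hvb, fun w hw i => ?_⟩
  have htmul : (1 : ResidueField R) ⊗ₜ[R] (∑ i, w i • v i) = 0 := by
    have hle : maximalIdeal R • (⊤ : Submodule R M) ≤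
        LinearMap.ker (TensorProduct.mk R (ResidueField R) M 1) := by
      refine Submodule.smul_le.mpr fun a ha y _ => ?_
      rw [LinearMap.mem_ker, TensorProduct.mk_apply, ← TensorProduct.smul_tmul, Algebra.smul_def,
        ResidueField.algebraMap_eq, (residue_eq_zero_iff a).mpr ha,
        zero_mul, TensorProduct.zero_tmul]
    exact hle hw
  have hsum : ∑ i, residue R (w i) • b i = 0 := by
    rw [← htmul, TensorProduct.tmul_sum]
    refine Finset.sum_congr rfl fun i _ => ?_
    rw [TensorProduct.tmul_smul, hvb]
    exact algebraMap_smul (ResidueField R) (w i) (b i)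
  exact (residue_eq_zero_iff _).mp
    (Fintype.linearIndependent_iff.mp b.linearIndependent _ hsum i)

theorem length_quotient_maximalIdeal_smul_top :
    Module.length R (M ⧸ maximalIdeal R • (⊤ : Submodule R M)) =
      minGenerators R M := by
  rw [minGenerators, ← Module.length_eq_finrank,
    ← Module.length_eq_of_surjective (S := R) residue_surjective]
  exact (TensorProduct.quotTensorEquivQuotSMul M (maximalIdeal R)).symm.length_eq

theorem length_eq_minGenerators (h : ∀ a ∈ maximalIdeal R, ∀ x : M, a • x = 0) :
    Module.length R M = minGenerators R M := by
  have hbot : maximalIdeal R • (⊤ : Submodule R M) = ⊥ :=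
    eq_bot_iff.mpr (Submodule.smul_le.mpr fun a ha x _ => h a ha x)
  rw [← length_quotient_maximalIdeal_smul_top]
  exact (Submodule.quotEquivOfEqBot _ hbot).symm.length_eq

theorem length_tensor_of_smul_eq_zero [Module.Finite R N]
    (h : ∀ a ∈ maximalIdeal R, ∀ x : N, a • x = 0) :
    Module.length R (M ⊗[R] N) = minGenerators R M * Module.length R N := by
  have hMN : ∀ a ∈ maximalIdeal R, ∀ z : M ⊗[R] N, a • z = 0 := by
    intro a ha z
    induction z with
    | zero => exact smul_zero a
    | add x y hx hy => rw [smul_add, hx, hy, add_zero]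
    | tmul x y => rw [← TensorProduct.tmul_smul, h a ha, TensorProduct.tmul_zero]
  rw [length_eq_minGenerators h, length_eq_minGenerators hMN, minGenerators,
    (TensorProduct.AlgebraTensorModule.distribBaseChange R
      (ResidueField R) M N).finrank_eq, Module.finrank_tensorProduct, Nat.cast_mul,
    minGenerators, minGenerators]

theorem length_quotient_maximalIdeal_mul [IsNoetherianRing R] (I : Ideal R) :
    Module.length R (R ⧸ maximalIdeal R * I) =
      Module.length R (R ⧸ I) + minGenerators R I := by
  have h := cokerLength_comp (maximalIdeal R • (⊤ : Submodule R I)).subtype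
    I.subtype I.subtype_injective
  rw [cokerLength, cokerLength, cokerLength, LinearMap.range_comp, Submodule.range_subtype,
    Submodule.range_subtype, Submodule.map_smul'', Submodule.map_top, Submodule.range_subtype,
    length_quotient_maximalIdeal_smul_top] at h
  rwa [add_comm]

theorem embDim_eq_minGenerators [IsNoetherianRing R] :
    embDim R = minGenerators R (maximalIdeal R) := by
  have h : (embDim R : ℕ∞) = minGenerators R (maximalIdeal R) := by
    rw [embDim, ← Module.length_eq_finrank, ← length_quotient_maximalIdeal_smul_top,
      ← Module.length_eq_of_surjective (S := R) residue_surjective]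
    rfl
  exact_mod_cast h

end MinimalGenerators

section GenericallyFree

open IsLocalRing

/-- `M` becomes isomorphic to `R ^ r` after inverting a suitable nonzerodivisor `c`, expressed by
a pair of maps whose composites are multiplication by `c`. -/
def GenericallyFree (R : Type*) [CommRing R] (M : Type*) [AddCommGroup M] [Module R M]
    (r : ℕ) : Prop :=
  ∃ c : R, IsRegular c ∧ ∃ (α : (Fin r → R) →ₗ[R] M) (β : M →ₗ[R] (Fin r → R)),
    α ∘ₗ β = c • LinearMap.id ∧ β ∘ₗ α = c • LinearMap.id

variable {R : Type*} [CommRing R] {M N : Type*} [AddCommGroup M] [AddCommGroup N] [Module R M]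
  [Module R N]

theorem injective_of_comp_eq_smul [Module.IsTorsionFree R M] {f : M →ₗ[R] N} {g : N →ₗ[R] M}
    {c : R} (hc : IsRegular c) (h : g ∘ₗ f = c • LinearMap.id) : Function.Injective f := by
  refine Function.Injective.of_comp (f := g) ?_
  rw [← LinearMap.coe_comp, h]
  exact hc.smul_right_injective M

theorem length_coker_ne_top_of_comp_eq_smul [IsNoetherianRing R] [Ring.KrullDimLE 1 R]
    [Module.Finite R N] {c : R} (hc : IsRegular c) {α : M →ₗ[R] N} {β : N →ₗ[R] M}
    (h : α ∘ₗ β = c • LinearMap.id) : cokerLength α ≠ ⊤ := by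
  refine length_ne_top_of_smul_eq_zero hc fun y => ?_
  obtain ⟨y, rfl⟩ := Submodule.Quotient.mk_surjective _ y
  rw [← Submodule.Quotient.mk_smul, Submodule.Quotient.mk_eq_zero]
  exact ⟨β y, LinearMap.congr_fun h y⟩

theorem GenericallyFree.cokerLength_lTensor [IsNoetherianRing R] [Ring.KrullDimLE 1 R]
    [Module.Finite R M] [Module.Finite R N] [Module.IsTorsionFree R N] {r : ℕ}
    (hM : GenericallyFree R M r) (f : N →ₗ[R] N) (hf : Function.Injective (f.lTensor M)) :
    cokerLength (f.lTensor M) = r * cokerLength f := by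
  obtain ⟨c, hc, α, β, hαβ, hβα⟩ := hM
  have : Module.IsTorsionFree R ((Fin r → R) ⊗[R] N) :=
    ((TensorProduct.comm R (Fin r → R) N).trans
      (TensorProduct.piScalarRight R R N (Fin r))).injective.moduleIsTorsionFree _ (map_smul _)
  have hαβN : α.rTensor N ∘ₗ β.rTensor N = c • LinearMap.id := by
    rw [← LinearMap.rTensor_comp, hαβ, LinearMap.rTensor_smul, LinearMap.rTensor_id]
  have hβαN : β.rTensor N ∘ₗ α.rTensor N = c • LinearMap.id := by
    rw [← LinearMap.rTensor_comp, hβα, LinearMap.rTensor_smul, LinearMap.rTensor_id]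
  rw [← cokerLength_lTensor_pi]
  refine (cokerLength_eq_of_comp_eq (α.rTensor N) (injective_of_comp_eq_smul hc hβαN)
    (length_coker_ne_top_of_comp_eq_smul hc hαβN) hf ?_).symm
  rw [LinearMap.lTensor_comp_rTensor, LinearMap.rTensor_comp_lTensor]

theorem GenericallyFree.free [IsLocalRing R] [Module.Finite R M] {r : ℕ}
    (hM : GenericallyFree R M r) (h : minGenerators R M = r) : Module.Free R M := by
  obtain ⟨c, hc, α, β, -, hβα⟩ := hM
  subst h
  obtain ⟨v, hspan, -⟩ := exists_minimal_generators (R := R) (M := M)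
  have hsurj : Function.Surjective (Fintype.linearCombination R v) := by
    rw [← LinearMap.range_eq_top, Fintype.range_linearCombination, hspan]
  have hinj := OrzechProperty.injective_of_surjective_of_injective α _
    (injective_of_comp_eq_smul hc hβα) hsurj
  exact Module.Free.of_equiv (LinearEquiv.ofBijective _ ⟨hinj, hsurj⟩)

/-- The inequality `μ(M) ≥ r` is forced to be an equality by comparing the lengths of
`M ⊗ coker F` and `coker (M ⊗ F)`. -/
theorem GenericallyFree.free_of_smul_mem_range [IsNoetherianRing R] [IsLocalRing R]
    [Ring.KrullDimLE 1 R] [Module.Finite R M] [Module.Finite R N] [Module.IsTorsionFree R N]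
    [Module.IsTorsionFree R (M ⊗[R] N)] {r : ℕ} (hM : GenericallyFree R M r) {c : R}
    (hc : IsRegular c) {F G : N →ₗ[R] N} (hGF : G ∘ₗ F = c • LinearMap.id)
    (hF : ¬ Function.Surjective F)
    (hmF : ∀ a ∈ maximalIdeal R, ∀ y, a • y ∈ LinearMap.range F) :
    Module.Free R M := by
  have hinj : Function.Injective (F.lTensor M) :=
    injective_of_comp_eq_smul (g := G.lTensor M) hc <| by
      rw [← LinearMap.lTensor_comp, hGF, LinearMap.lTensor_smul, LinearMap.lTensor_id]
  have hkill : ∀ a ∈ maximalIdeal R, ∀ y : N ⧸ LinearMap.range F, a • y = 0 := by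
    intro a ha y
    obtain ⟨y, rfl⟩ := Submodule.Quotient.mk_surjective _ y
    rw [← Submodule.Quotient.mk_smul, Submodule.Quotient.mk_eq_zero]
    exact hmF a ha y
  have hlength : minGenerators R M * cokerLength F = r * cokerLength F := by
    rw [← hM.cokerLength_lTensor F hinj, _root_.cokerLength_lTensor,
      length_tensor_of_smul_eq_zero hkill, cokerLength]
  have hfinite : cokerLength F ≠ ⊤ := by
    rw [cokerLength, length_eq_minGenerators hkill]
    exact ENat.natCast_ne_top _
  have hpos : cokerLength F ≠ 0 := (cokerLength_eq_zero_iff F).not.mpr hF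
  lift cokerLength F to ℕ using hfinite with l
  exact hM.free <| Nat.eq_of_mul_eq_mul_right (Nat.pos_of_ne_zero (mod_cast hpos))
    (mod_cast hlength)

end GenericallyFree

section Rank

variable {R : Type*} [CommRing R] {M : Type*} [AddCommGroup M] [Module R M]

theorem free_and_finrank_eq_of_localization_under {S : Type*} [CommRing S] [Algebra R S]
    (P : Ideal S) [P.IsPrime]
    [Module.Free (Localization.AtPrime (P.under R)) (LocalizedModule (P.under R).primeCompl M)] :
    Module.Free (Localization.AtPrime P) (Localization.AtPrime P ⊗[S] (S ⊗[R] M)) ∧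
      Module.finrank (Localization.AtPrime P) (Localization.AtPrime P ⊗[S] (S ⊗[R] M)) =
        Module.finrank (Localization.AtPrime (P.under R))
          (LocalizedModule (P.under R).primeCompl M) := by
  let Rp := Localization.AtPrime (P.under R)
  let SP := Localization.AtPrime P
  let _ : Algebra Rp SP := Localization.AtPrime.algebraOfLiesOver (P.under R) P
  let e : SP ⊗[Rp] LocalizedModule (P.under R).primeCompl M ≃ₗ[SP] SP ⊗[S] (S ⊗[R] M) :=
    ((LocalizedModule.equivTensorProduct (P.under R).primeCompl M).baseChange Rp SP _ _).trans <|
      (TensorProduct.AlgebraTensorModule.cancelBaseChange R Rp SP SP M).trans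
        (TensorProduct.AlgebraTensorModule.cancelBaseChange R S SP SP M).symm
  exact ⟨Module.Free.of_equiv e, by rw [← e.finrank_eq, Module.finrank_baseChange]⟩

theorem finrank_quotient_tensor_eq {N : Type*} [AddCommGroup N] [Module R N] (P : Ideal R)
    [P.IsMaximal] [Module.Free (Localization.AtPrime P) (Localization.AtPrime P ⊗[R] N)] :
    Module.finrank (R ⧸ P) ((R ⧸ P) ⊗[R] N) =
      Module.finrank (Localization.AtPrime P) (Localization.AtPrime P ⊗[R] N) := by
  let _ := Ideal.Quotient.field P
  rw [← Module.finrank_baseChange (R := P.ResidueField) (S := R ⧸ P),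
    ← Module.finrank_baseChange (R := P.ResidueField) (S := Localization.AtPrime P)]
  exact ((TensorProduct.AlgebraTensorModule.cancelBaseChange R _ P.ResidueField _ N).trans
    (TensorProduct.AlgebraTensorModule.cancelBaseChange R _ P.ResidueField _ N).symm).finrank_eq

/-- The total ring of fractions of `R` is semilocal, and its maximal ideals contract to associated
primes of `R`. -/
theorem HasModuleRank.nonempty_basis_fractionRing [IsNoetherianRing R] [Module.Finite R M] {r : ℕ}
    (h : HasModuleRank R M r) :
    Nonempty (Module.Basis (Fin r) (FractionRing R) (FractionRing R ⊗[R] M)) := by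
  let Q := FractionRing R
  have : IsNoetherianRing Q := IsLocalization.isNoetherianRing (nonZeroDivisors R) Q ‹_›
  have hP (P : Ideal Q) [P.IsMaximal] :
      Module.Free (Localization.AtPrime P) (Localization.AtPrime P ⊗[Q] (Q ⊗[R] M)) ∧
        Module.finrank (Localization.AtPrime P) (Localization.AtPrime P ⊗[Q] (Q ⊗[R] M)) = r := by
    have hass : P.under R ∈ associatedPrimes R R := open Module.associatedPrimes in
      comap_mem_associatedPrimes_of_mem_associatedPrimes_of_isLocalizedModule_of_fg
        (nonZeroDivisors R) (Algebra.linearMap R Q) P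
        (Ideal.IsMaximal.mem_associatedPrimes_of_isFractionRing Q P) (IsNoetherian.noetherian _)
    obtain ⟨_, hrank⟩ := h (P.under R) hass
    rw [← hrank]
    exact free_and_finrank_eq_of_localization_under P
  have : Module.Flat Q (Q ⊗[R] M) := by
    refine Module.flat_of_isLocalized_maximal _ _
      (fun P _ => Localization.AtPrime P ⊗[Q] (Q ⊗[R] M))
      (fun P _ => TensorProduct.mk Q (Localization.AtPrime P) _ 1) fun P _ => ?_
    have := (hP P).1
    exact Module.Flat.trans Q (Localization.AtPrime P) _
  refine Module.nonempty_basis_of_flat_of_finrank_eq Q _ r fun P => ?_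
  have := P.isMaximal
  have := (hP P.asIdeal).1
  rw [finrank_quotient_tensor_eq, (hP P.asIdeal).2]

theorem genericallyFree_of_basis_fractionRing [IsNoetherianRing R] [Module.Finite R M] {r : ℕ}
    (b : Module.Basis (Fin r) (FractionRing R) (FractionRing R ⊗[R] M)) :
    GenericallyFree R M r := by
  let Q := FractionRing R
  let e : Q ⊗[R] M ≃ₗ[R] (Fin r → Q) := b.equivFun.restrictScalars R
  let ι : (Fin r → R) →ₗ[R] (Fin r → Q) := LinearMap.pi fun i =>
    Algebra.linearMap R Q ∘ₗ LinearMap.proj i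
  let j : M →ₗ[R] Q ⊗[R] M := TensorProduct.mk R Q M 1
  have hι : Function.Injective ι := (IsFractionRing.injective R Q).comp_left
  have : Module.FinitePresentation R M := Module.finitePresentation_of_finite R M
  obtain ⟨α, s, hα⟩ := Module.FinitePresentation.exists_lift_of_isLocalizedModule
    (nonZeroDivisors R) j (e.symm.toLinearMap ∘ₗ ι)
  obtain ⟨β, t, hβ⟩ := Module.FinitePresentation.exists_lift_of_isLocalizedModule
    (nonZeroDivisors R) ι (e.toLinearMap ∘ₗ j)
  have hα' (v : Fin r → R) : j (α v) = s.1 • e.symm (ι v) := LinearMap.congr_fun hα v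
  have hβ' (y : M) : ι (β y) = t.1 • e (j y) := LinearMap.congr_fun hβ y
  have hβα (v : Fin r → R) : β (α v) = (s.1 * t.1) • v := by
    apply hι
    rw [hβ', hα', map_smul, e.apply_symm_apply, map_smul, smul_smul, mul_comm]
  have hαβ : j ∘ₗ α ∘ₗ β = j ∘ₗ ((s.1 * t.1) • LinearMap.id) := by
    refine LinearMap.ext fun y => ?_
    simp only [LinearMap.comp_apply, LinearMap.smul_apply, LinearMap.id_apply, hα', hβ', map_smul,
      e.symm_apply_apply, smul_smul]
  obtain ⟨u, hu⟩ :=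
    Module.Finite.exists_smul_of_comp_eq_of_isLocalizedModule (nonZeroDivisors R) j _ _ hαβ
  refine ⟨u * (s * t), isRegular_iff_mem_nonZeroDivisors.mpr (u * (s * t)).2, u.1 • α, β, ?_, ?_⟩
  · rw [LinearMap.smul_comp, mul_smul]
    exact hu
  · refine LinearMap.ext fun v => ?_
    rw [LinearMap.comp_apply, LinearMap.smul_apply, map_smul, hβα, smul_smul]
    rfl

theorem HasModuleRank.genericallyFree [IsNoetherianRing R] [Module.Finite R M] {r : ℕ}
    (h : HasModuleRank R M r) : GenericallyFree R M r :=
  genericallyFree_of_basis_fractionRing h.nonempty_basis_fractionRing.some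

end Rank

section Trace

open IsLocalRing

variable {R : Type*} [CommRing R] {M : Type*} [AddCommGroup M] [Module R M]

theorem apply_mem_traceIdeal (f : Module.Dual R M) (y : M) : f y ∈ traceIdeal R M :=
  ⟨f ⊗ₜ y, contractLeft_apply f y⟩

theorem apply_mem_map_traceIdeal {A : Type*} [CommRing A] [Algebra R A] [Module.Free R A]
    (g : M →ₗ[R] A) (y : M) : g y ∈ (traceIdeal R M).map (algebraMap R A) := by
  let b := Module.Free.chooseBasis R A
  rw [← b.linearCombination_repr (g y), Finsupp.linearCombination_apply]
  refine Ideal.sum_mem _ fun i _ => ?_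
  beta_reduce
  rw [Algebra.smul_def]
  exact Ideal.mul_mem_right _ _ (Ideal.mem_map_of_mem _ (apply_mem_traceIdeal (b.coord i ∘ₗ g) y))

theorem isTorsionFree_tensor_linearMap {A : Type*} [AddCommGroup A] [Module R A] [Module.Free R A]
    [Module.Finite R A] [Module.IsTorsionFree R (M ⊗[R] Module.Dual R M)] :
    Module.IsTorsionFree R (M ⊗[R] (M →ₗ[R] A)) := by
  classical
  let b := (Module.Free.chooseBasis R A).equivFun
  let e : (M →ₗ[R] A) ≃ₗ[R] (Module.Free.ChooseBasisIndex R A → Module.Dual R M) :=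
    (LinearEquiv.congrRight b).trans (LinearEquiv.linearMapPi R).symm
  let e' := (TensorProduct.congr (LinearEquiv.refl R M) e).trans (TensorProduct.piRight R R M _)
  exact e'.injective.moduleIsTorsionFree _ (map_smul e')

theorem exists_mulLeft_comp_mulLeft_eq_smul {A : Type*} [CommRing A] [Algebra R A] {x : A} {c : R}
    (h : algebraMap R A c ∈ Ideal.span {x}) :
    ∃ z : A, LinearMap.mulLeft R z ∘ₗ LinearMap.mulLeft R x = c • LinearMap.id := by
  obtain ⟨z, hz⟩ := Ideal.mem_span_singleton'.mp h
  refine ⟨z, LinearMap.ext fun y => ?_⟩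
  rw [LinearMap.comp_apply, LinearMap.mulLeft_apply, LinearMap.mulLeft_apply, ← mul_assoc, hz,
    LinearMap.smul_apply, LinearMap.id_apply, Algebra.smul_def]

theorem exists_comp_eq_of_range_le {N P : Type*} [AddCommGroup N] [AddCommGroup P] [Module R N]
    [Module R P] {f : N →ₗ[R] P} (hf : Function.Injective f) {g : M →ₗ[R] P}
    (h : LinearMap.range g ≤ LinearMap.range f) : ∃ k : M →ₗ[R] N, f ∘ₗ k = g := by
  refine ⟨(LinearEquiv.ofInjective f hf).symm ∘ₗ g.codRestrict _ fun y => h ⟨y, rfl⟩, ?_⟩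
  ext y
  simp

theorem not_isUnit_of_span_singleton_mul_map_pow_eq [IsNoetherianRing R] [IsLocalRing R]
    {A : Type*} [CommRing A] [Algebra R A] [Module.FaithfullyFlat R A] {x : A} {n : ℕ}
    (hx : Ideal.span {x} * (maximalIdeal R ^ n).map (algebraMap R A) =
      (maximalIdeal R ^ (n + 1)).map (algebraMap R A))
    {c : R} (hcm : c ∈ maximalIdeal R) (hc : IsRegular c) : ¬ IsUnit x := by
  intro hu
  rw [Ideal.span_singleton_eq_top.mpr hu, Ideal.top_mul] at hx
  have hle : maximalIdeal R ^ n ≤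
      maximalIdeal R • maximalIdeal R ^ n := by
    rw [smul_eq_mul, ← pow_succ', ← Ideal.comap_map_eq_self_of_faithfullyFlat (B := A) (_ ^ n), hx,
      Ideal.comap_map_eq_self_of_faithfullyFlat]
  have hbot := Submodule.eq_bot_of_le_smul_of_le_jacobson_bot _ _ (IsNoetherian.noetherian _) hle
    (maximalIdeal_le_jacobson _)
  have hcn : c ^ n ∈ (⊥ : Ideal R) := hbot ▸ Ideal.pow_mem_pow hcm n
  exact (hc.pow n).ne_zero hcn

variable [IsNoetherianRing R] [Module.Finite R M]

theorem GenericallyFree.not_surjective_mul {r : ℕ} (hM : GenericallyFree R M r) (hr : 0 < r)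
    {A : Type*} [CommRing A] [Algebra R A] [Module.Free R A] [Module.Finite R A] {x : A}
    (hx : ¬ IsUnit x) : ¬ Function.Surjective ((LinearMap.mulLeft R x).compRight R (M := M)) := by
  intro hsurj
  obtain ⟨c, hc, α, β, -, hβα⟩ := hM
  have : Module.Finite A (M →ₗ[R] A) := Module.Finite.of_restrictScalars_finite R A _
  obtain ⟨d, hd, hdN⟩ := Submodule.exists_sub_one_mem_and_smul_eq_zero_of_fg_of_le_smul
    (Ideal.span {x}) (⊤ : Submodule A (M →ₗ[R] A)) Module.Finite.fg_top fun g _ => by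
      obtain ⟨g, rfl⟩ := hsurj g
      exact Submodule.smul_mem_smul (Ideal.mem_span_singleton_self x) (Submodule.mem_top (x := g))
  let v : Fin r → R := Pi.single ⟨0, hr⟩ 1
  have hdc : c • d = 0 := by
    have h := LinearMap.congr_fun
      (hdN (Algebra.linearMap R A ∘ₗ LinearMap.proj ⟨0, hr⟩ ∘ₗ β) Submodule.mem_top) (α v)
    have hv : β (α v) = c • v := LinearMap.congr_fun hβα v
    simpa [hv, v, Algebra.smul_def, mul_comm] using h
  have hd0 : d = 0 := hc.isSMulRegular.right_eq_zero_of_smul hdc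
  rw [hd0, zero_sub, Ideal.neg_mem_iff, Ideal.mem_span_singleton] at hd
  exact hx (isUnit_of_dvd_one hd)

/-- Multiplication by `x` on `Hom(M, A)` has a cokernel killed by the maximal ideal. -/
theorem GenericallyFree.free_of_traceIdeal_le_pow [IsLocalRing R] [Ring.KrullDimLE 1 R] {r : ℕ}
    (hM : GenericallyFree R M r) (hr : 0 < r)
    [Module.IsTorsionFree R (M ⊗[R] Module.Dual R M)] {A : Type*} [CommRing A] [Nontrivial A]
    [Algebra R A] [Module.Free R A] [Module.Finite R A] {x : A} {n : ℕ}
    (htr : traceIdeal R M ≤ maximalIdeal R ^ n)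
    (hx : Ideal.span {x} * (maximalIdeal R ^ n).map (algebraMap R A) =
      (maximalIdeal R ^ (n + 1)).map (algebraMap R A))
    {c : R} (hcm : c ∈ maximalIdeal R) (hc : IsRegular c) : Module.Free R M := by
  have hle : (maximalIdeal R ^ (n + 1)).map (algebraMap R A) ≤ Ideal.span {x} :=
    hx ▸ Ideal.mul_le_left
  obtain ⟨z, hzx⟩ := exists_mulLeft_comp_mulLeft_eq_smul <|
    hle (Ideal.mem_map_of_mem _ (Ideal.pow_mem_pow hcm (n + 1)))
  have hinj : Function.Injective (LinearMap.mulLeft R x) := injective_of_comp_eq_smul (hc.pow _) hzx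
  have := isTorsionFree_tensor_linearMap (R := R) (M := M) (A := A)
  refine hM.free_of_smul_mem_range (hc.pow (n + 1)) (F := (LinearMap.mulLeft R x).compRight R)
    (G := (LinearMap.mulLeft R z).compRight R) ?_ (hM.not_surjective_mul hr
      (not_isUnit_of_span_singleton_mul_map_pow_eq hx hcm hc)) fun a ha g => ?_
  · exact LinearMap.ext fun g => LinearMap.ext fun y => LinearMap.congr_fun hzx (g y)
  · refine exists_comp_eq_of_range_le hinj (LinearMap.range_le_iff_comap.mpr ?_)
    refine eq_top_iff.mpr fun y _ => ?_
    obtain ⟨w, hw⟩ := Ideal.mem_span_singleton'.mp <| hle <| by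
      rw [pow_succ', Ideal.map_mul]
      exact Ideal.mul_mem_mul (Ideal.mem_map_of_mem _ ha)
        (Ideal.map_mono htr (apply_mem_map_traceIdeal g y))
    exact ⟨w, by simp [Algebra.smul_def, ← hw, mul_comm]⟩

end Trace

section Splitting

open IsLocalRing

variable {R : Type*} [CommRing R] {M N : Type*} [AddCommGroup M] [Module R M]
  [AddCommGroup N] [Module R N]

theorem GenericallyFree.free_of_forall_isUnit {r : ℕ} (hM : GenericallyFree R M r)
    (h : ∀ c : R, IsRegular c → IsUnit c) : Module.Free R M := by
  obtain ⟨c, hc, α, β, hαβ, hβα⟩ := hM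
  obtain ⟨u, rfl⟩ := h c hc
  refine Module.Free.of_equiv (LinearEquiv.ofLinearMap α ((↑u⁻¹ : R) • β) ?_ ?_)
  · rw [LinearMap.comp_smul, hαβ, smul_smul, Units.inv_mul, one_smul]
  · rw [LinearMap.smul_comp, hβα, smul_smul, Units.inv_mul, one_smul]

theorem GenericallyFree.subsingleton [Module.IsTorsionFree R M] (hM : GenericallyFree R M 0) :
    Subsingleton M := by
  obtain ⟨c, hc, α, β, hαβ, -⟩ := hM
  exact (injective_of_comp_eq_smul hc hαβ).subsingleton

theorem HasModuleRank.of_linearEquiv_prod [Module.Finite R N] {r : ℕ}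
    (h : HasModuleRank R M (r + 1)) (e : M ≃ₗ[R] R × N) : HasModuleRank R N r := by
  intro p _ hp
  obtain ⟨_, hrank⟩ := h p hp
  let Rp := Localization.AtPrime p
  let Np := LocalizedModule p.primeCompl N
  let E : LocalizedModule p.primeCompl M ≃ₗ[Rp] Rp × Np :=
    (LocalizedModule.equivTensorProduct p.primeCompl M).trans <|
      (e.baseChange R Rp M (R × N)).trans <|
      (TensorProduct.prodRight R Rp Rp R N).trans <|
      LinearEquiv.prodCongr (TensorProduct.AlgebraTensorModule.rid R Rp Rp)
        (LocalizedModule.equivTensorProduct p.primeCompl N).symm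
  have : Module.Finite Rp Np :=
    Module.Finite.of_isLocalizedModule p.primeCompl (LocalizedModule.mkLinearMap p.primeCompl N)
  have : Module.Free Rp (Rp × Np) := Module.Free.of_equiv E
  have : Module.Projective Rp Np :=
    Module.Projective.of_split (LinearMap.inr Rp Rp _) (LinearMap.snd Rp Rp _)
      (LinearMap.snd_comp_inr _ _ _)
  have hfree : Module.Free Rp Np := Module.free_of_flat_of_isLocalRing
  have hsum : 1 + Module.finrank Rp Np = 1 + r := by
    rw [add_comm 1 r, ← hrank, E.finrank_eq, Module.finrank_prod, Module.finrank_self]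
  exact ⟨hfree, Nat.add_left_cancel hsum⟩

theorem exists_apply_eq_one_of_traceIdeal_eq_top [IsLocalRing R] (h : traceIdeal R M = ⊤) :
    ∃ (f : Module.Dual R M) (y : M), f y = 1 := by
  suffices hu : ∃ (f : Module.Dual R M) (y : M), IsUnit (f y) by
    obtain ⟨f, y, u, hu⟩ := hu
    refine ⟨f, (↑u⁻¹ : R) • y, ?_⟩
    rw [map_smul, ← hu, smul_eq_mul, Units.inv_mul]
  by_contra! hnonunit
  have hle : traceIdeal R M ≤ maximalIdeal R := by
    rintro _ ⟨z, rfl⟩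
    induction z with
    | zero => rw [map_zero]; exact zero_mem _
    | add x y hx hy => rw [map_add]; exact add_mem hx hy
    | tmul f y => rw [contractLeft_apply]; exact hnonunit f y
  exact Ideal.IsPrime.ne_top' (top_le_iff.mp (h ▸ hle))

theorem nonempty_linearEquiv_prod_ker {f : Module.Dual R M} {y : M} (hy : f y = 1) :
    Nonempty (M ≃ₗ[R] R × LinearMap.ker f) := by
  let π : M →ₗ[R] LinearMap.ker f :=
    (LinearMap.id - f.smulRight y).codRestrict _ fun z => by simp [hy]
  have hπ : ∀ z, (π z : M) = z - f z • y := fun z => rfl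
  refine ⟨LinearEquiv.ofLinearMap (f.prod π)
    ((LinearMap.toSpanSingleton R M y).coprod (LinearMap.ker f).subtype) ?_ ?_⟩
  · ext x <;> simp [hπ, hy]
  · ext x
    simp [hπ]

theorem isTorsionFree_of_linearEquiv_prod [Module.IsTorsionFree R (M ⊗[R] Module.Dual R M)]
    (e : M ≃ₗ[R] R × N) : Module.IsTorsionFree R N := by
  let s : M := e.symm (1, 0)
  let i : N →ₗ[R] M ⊗[R] Module.Dual R M :=
    (TensorProduct.mk R M (Module.Dual R M)).flip (LinearMap.fst R R N ∘ₗ e.toLinearMap) ∘ₗ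
      e.symm.toLinearMap ∘ₗ LinearMap.inr R R N
  let p : M ⊗[R] Module.Dual R M →ₗ[R] N :=
    TensorProduct.lift ((LinearMap.lsmul R N).flip.compl₂ (Module.Dual.eval R M s) ∘ₗ
      LinearMap.snd R R N ∘ₗ e.toLinearMap)
  have hpi : Function.LeftInverse p i := fun x => by simp [p, i, s]
  exact hpi.injective.moduleIsTorsionFree i (map_smul i)

theorem isTorsionFree_tensor_dual_of_linearEquiv_prod
    [Module.IsTorsionFree R (M ⊗[R] Module.Dual R M)] (e : M ≃ₗ[R] R × N) :
    Module.IsTorsionFree R (N ⊗[R] Module.Dual R N) := by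
  let ι : N →ₗ[R] M := e.symm.toLinearMap ∘ₗ LinearMap.inr R R N
  let π : M →ₗ[R] N := LinearMap.snd R R N ∘ₗ e.toLinearMap
  have hπι : π ∘ₗ ι = LinearMap.id := by
    ext x
    simp [π, ι]
  have hdual : ι.dualMap ∘ₗ π.dualMap = LinearMap.id := by
    rw [LinearMap.dualMap_comp_dualMap, hπι, LinearMap.dualMap_id]
  have hleft : Function.LeftInverse (TensorProduct.map π ι.dualMap)
      (TensorProduct.map ι π.dualMap) := fun z => by
    rw [← LinearMap.comp_apply, ← TensorProduct.map_comp, hπι, hdual, TensorProduct.map_id,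
      LinearMap.id_apply]
  exact hleft.injective.moduleIsTorsionFree _ (map_smul _)

/-- Splitting off free summands of `M` reduces to the case of a proper trace ideal. -/
theorem HasModuleRank.free_of_span_singleton_mul_map_eq [IsNoetherianRing R] [IsLocalRing R]
    [Ring.KrullDimLE 1 R] [Module.Finite R M] [Module.IsTorsionFree R (M ⊗[R] Module.Dual R M)]
    {r : ℕ} (hM : HasModuleRank R M r) (hr : 0 < r ∨ Subsingleton M) {A : Type*} [CommRing A]
    [Nontrivial A] [Algebra R A] [Module.Free R A] [Module.Finite R A] {x : A}
    (hx : Ideal.span {x} * (maximalIdeal R).map (algebraMap R A) =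
      (maximalIdeal R ^ 2).map (algebraMap R A))
    {c : R} (hcm : c ∈ maximalIdeal R) (hc : IsRegular c) : Module.Free R M := by
  induction r generalizing M with
  | zero =>
    have : Subsingleton M := hr.resolve_left (lt_irrefl 0)
    exact Module.Free.of_subsingleton R M
  | succ r ih =>
    by_cases htop : traceIdeal R M = ⊤
    · obtain ⟨f, y, hy⟩ := exists_apply_eq_one_of_traceIdeal_eq_top htop
      obtain ⟨e⟩ := nonempty_linearEquiv_prod_ker hy
      have hK := hM.of_linearEquiv_prod e
      have := isTorsionFree_of_linearEquiv_prod e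
      have := isTorsionFree_tensor_dual_of_linearEquiv_prod e
      have : Module.Free R (LinearMap.ker f) := by
        refine ih (M := LinearMap.ker f) hK ?_
        rcases Nat.eq_zero_or_pos r with rfl | hr
        · exact Or.inr hK.genericallyFree.subsingleton
        · exact Or.inl hr
      exact Module.Free.of_equiv e.symm
    · refine hM.genericallyFree.free_of_traceIdeal_le_pow r.succ_pos (x := x) (n := 1) ?_ ?_
        hcm hc
      · exact (pow_one (maximalIdeal R)).symm ▸ le_maximalIdeal htop
      · rwa [pow_one]

end Splitting

section RatliffRush

variable {R : Type*} [CommRing R]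

theorem mem_smul_top_pi_iff {ι : Type*} [Finite ι] {J : Ideal R} {z : ι → R} :
    z ∈ J • (⊤ : Submodule R (ι → R)) ↔ ∀ i, z i ∈ J := by
  classical
  have := Fintype.ofFinite ι
  refine ⟨fun hz i => ?_, fun hz => ?_⟩
  · have hi : (LinearMap.proj i : (ι → R) →ₗ[R] R) z ∈
        (J • (⊤ : Submodule R (ι → R))).map (LinearMap.proj i) := ⟨z, hz, rfl⟩
    rw [Submodule.map_smul''] at hi
    exact Ideal.mul_le_left hi
  · rw [pi_eq_sum_univ' z]
    exact Submodule.sum_mem _ fun i _ => Submodule.smul_mem_smul (hz i) Submodule.mem_top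

variable [IsNoetherianRing R]

/-- Artin–Rees for the image of `a ↦ (a gᵢ)ᵢ`, where the `gᵢ` generate `I`. -/
theorem exists_forall_le_pow_of_mul_le_pow_succ {I : Ideal R} {c : R} (hcI : c ∈ I)
    (hc : IsRegular c) : ∃ k, ∀ n ≥ k, ∀ K : Ideal R, I * K ≤ I ^ (n + 1) → K ≤ I ^ n := by
  obtain ⟨s, g, hg⟩ := Submodule.fg_iff_exists_fin_generating_family.mp
    (IsNoetherian.noetherian I)
  let D : R →ₗ[R] (Fin s → R) := LinearMap.toSpanSingleton R (Fin s → R) g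
  have hD : ∀ (J : Ideal R) (a : R), D a ∈ J • (⊤ : Submodule R (Fin s → R)) ↔
      a ∈ J.colon (I : Set R) := by
    intro J a
    rw [mem_smul_top_pi_iff, ← hg, Submodule.colon_span, Submodule.mem_colon, Set.forall_mem_range]
    rfl
  have hDinj : Function.Injective D := by
    rw [injective_iff_map_eq_zero]
    intro a ha
    have hac : a * c = 0 := Submodule.mem_colon.mp ((hD ⊥ a).mp (ha ▸ zero_mem _)) c hcI
    exact hc.right.mul_right_eq_zero_iff.mp hac
  obtain ⟨k, hk⟩ := I.exists_pow_inf_eq_pow_smul (LinearMap.range D)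
  let L : Ideal R := (I ^ k).colon (I : Set R)
  have hL : I ^ k • (⊤ : Submodule R (Fin s → R)) ⊓ LinearMap.range D ≤ Submodule.map D L := by
    rintro _ ⟨hz, a, rfl⟩
    exact ⟨a, (hD _ a).mp hz, rfl⟩
  have hIL : I * L ≤ I ^ k := Ideal.mul_le.mpr fun y hy b hb => by
    rw [mul_comm]
    exact Submodule.mem_colon.mp hb y hy
  refine ⟨k, fun n hn K hK a ha => ?_⟩
  obtain ⟨l, rfl⟩ := Nat.exists_eq_add_of_le hn
  have hDa : D a ∈ I ^ (k + l + 1) • (⊤ : Submodule R (Fin s → R)) ⊓ LinearMap.range D :=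
    ⟨(hD _ a).mpr (Submodule.mem_colon.mpr fun y hy =>
      hK (mul_comm K I ▸ Ideal.mul_mem_mul ha hy)), a, rfl⟩
  rw [hk (k + l + 1) (by omega), add_assoc, Nat.add_sub_cancel_left] at hDa
  have hmap := Submodule.smul_mono (le_refl (I ^ (l + 1))) hL hDa
  rw [← Submodule.map_smul''] at hmap
  have haL : a ∈ I ^ (l + 1) • L := hDinj.mem_set_image.mp hmap
  rw [pow_succ, smul_eq_mul, mul_assoc] at haL
  rw [add_comm, pow_add]
  exact Ideal.mul_mono_right hIL haL

theorem exists_forall_le_pow_of_pow_mul_le_pow_add {I : Ideal R} {c : R} (hcI : c ∈ I)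
    (hc : IsRegular c) :
    ∃ k, ∀ n ≥ k, ∀ (d : ℕ) (K : Ideal R), I ^ d * K ≤ I ^ (n + d) → K ≤ I ^ n := by
  obtain ⟨k, hk⟩ := exists_forall_le_pow_of_mul_le_pow_succ hcI hc
  refine ⟨k, fun n hn d => ?_⟩
  induction d with
  | zero => simp
  | succ d ih =>
    intro K hK
    refine ih K (hk (n + d) (by omega) _ ?_)
    rwa [← mul_assoc, ← pow_succ']

end RatliffRush

section DedekindMertens

open Polynomial

variable {R : Type*} [CommRing R]

theorem contentIdeal_le_iff {p : R[X]} {I : Ideal R} :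
    p.contentIdeal ≤ I ↔ ∀ i, p.coeff i ∈ I := by
  refine ⟨fun h i => h (p.coeff_mem_contentIdeal i), fun h => Ideal.span_le.mpr fun a ha => ?_⟩
  obtain ⟨i, -, rfl⟩ := mem_coeffs_iff.mp ha
  exact h i

theorem contentIdeal_mul_contentIdeal_le {p q : R[X]} {I : Ideal R}
    (h : ∀ i j, p.coeff i * q.coeff j ∈ I) : p.contentIdeal * q.contentIdeal ≤ I := by
  rw [contentIdeal_def, contentIdeal_def, Ideal.span_mul_span', Ideal.span_le, Set.mul_subset_iff]
  intro a ha b hb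
  obtain ⟨i, -, rfl⟩ := mem_coeffs_iff.mp ha
  obtain ⟨j, -, rfl⟩ := mem_coeffs_iff.mp hb
  exact h i j

theorem exists_contentIdeal_eq {I : Ideal R} (hI : I.FG) : ∃ p : R[X], p.contentIdeal = I := by
  obtain ⟨s, g, rfl⟩ := Submodule.fg_iff_exists_fin_generating_family.mp hI
  have hcoeff : ∀ i, (∑ j : Fin s, monomial (j : ℕ) (g j)).coeff i =
      ∑ j : Fin s, if (j : ℕ) = i then g j else 0 := by
    simp only [finsetSum_coeff, coeff_monomial, implies_true]
  refine ⟨∑ j : Fin s, monomial (j : ℕ) (g j),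
    le_antisymm (contentIdeal_le_iff.mpr fun i => ?_) (Submodule.span_le.mpr ?_)⟩
  · rw [hcoeff]
    refine Ideal.sum_mem _ fun j _ => ?_
    split_ifs
    · exact Submodule.subset_span ⟨j, rfl⟩
    · exact zero_mem _
  · rintro _ ⟨j, rfl⟩
    convert coeff_mem_contentIdeal (∑ j : Fin s, monomial (j : ℕ) (g j)) j
    simp [hcoeff, Fin.val_inj]

theorem coeff_mul_coeff_mem {p q : R[X]} {T : Ideal R} {d i : ℕ} (hq : q.natDegree ≤ d)
    (hpq : (p * q).coeff (i + d) ∈ T) (hi : ∀ j > i, ∀ l, p.coeff j * q.coeff l ∈ T) :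
    p.coeff i * q.coeff d ∈ T := by
  rw [coeff_mul, ← Finset.add_sum_erase _ _
    (Finset.HasAntidiagonal.mem_antidiagonal.mpr (rfl : (i, d).1 + (i, d).2 = i + d))] at hpq
  refine (Ideal.add_mem_iff_left _ (Ideal.sum_mem _ fun jl hjl => ?_)).mp hpq
  rw [Finset.mem_erase, Finset.HasAntidiagonal.mem_antidiagonal] at hjl
  obtain ⟨hne, hjl⟩ := hjl
  rcases lt_trichotomy jl.1 i with h | h | h
  · rw [coeff_eq_zero_of_natDegree_lt (by omega : q.natDegree < jl.2), mul_zero]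
    exact zero_mem _
  · exact absurd (Prod.ext h (by omega)) hne
  · exact hi jl.1 h jl.2

/-- By descending induction on `i`, the product `pᵢ q_d` lies in `T` as soon as the `pⱼ q_l` with
`j > i` do. -/
theorem contentIdeal_mul_contentIdeal_le_of_natDegree_le {p q : R[X]} {T : Ideal R} {d : ℕ}
    (hq : q.natDegree ≤ d) (hpq : (p * q).contentIdeal ≤ T)
    (h : ∀ i, p.coeff i * q.coeff d ∈ T → ∀ l, p.coeff i * q.coeff l ∈ T) :
    p.contentIdeal * q.contentIdeal ≤ T := by
  have key : ∀ j i, p.natDegree < i + j → ∀ l, p.coeff i * q.coeff l ∈ T := by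
    intro j
    induction j with
    | zero =>
      intro i hi l
      rw [coeff_eq_zero_of_natDegree_lt (by omega), zero_mul]
      exact zero_mem _
    | succ j ih =>
      exact fun i hi => h i <| coeff_mul_coeff_mem hq (hpq (coeff_mem_contentIdeal _ _))
        fun i' hi' => ih i' (by omega)
  exact contentIdeal_mul_contentIdeal_le fun i l => key (p.natDegree + 1) i (by omega) l

theorem contentIdeal_mul_erase_le (p q : R[X]) (d : ℕ) :
    (p * q.erase d).contentIdeal ≤
      (p * q).contentIdeal ⊔ p.contentIdeal * Ideal.span {q.coeff d} := by
  rw [contentIdeal_le_iff]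
  intro i
  rw [eq_sub_of_add_eq' (monomial_add_erase q d), mul_sub, coeff_sub]
  refine sub_mem (Ideal.mem_sup_left (coeff_mem_contentIdeal _ i)) (Ideal.mem_sup_right ?_)
  rw [← contentIdeal_monomial d]
  exact contentIdeal_mul_le_mul_contentIdeal _ _ (coeff_mem_contentIdeal _ i)

theorem natDegree_erase_succ_le {q : R[X]} {d : ℕ} (hq : q.natDegree ≤ d + 1) :
    (q.erase (d + 1)).natDegree ≤ d := by
  refine natDegree_le_iff_coeff_eq_zero.mpr fun l hl => ?_
  rw [coeff_erase]
  split_ifs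
  · rfl
  · exact coeff_eq_zero_of_natDegree_lt (by omega)

theorem mul_contentIdeal_erase_mul_pow_le {p q : R[X]} {P : Ideal R} (hP : P ≤ p.contentIdeal)
    {d e : ℕ} (herase : p.contentIdeal ^ (d + 1) * (q.erase e).contentIdeal ≤
      p.contentIdeal ^ d * (p * q.erase e).contentIdeal)
    (hlead : P * Ideal.span {q.coeff e} * p.contentIdeal ^ (d + 1) ≤
      p.contentIdeal ^ (d + 1) * (p * q).contentIdeal) :
    P * (q.erase e).contentIdeal * p.contentIdeal ^ (d + 1) ≤
      p.contentIdeal ^ (d + 1) * (p * q).contentIdeal := by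
  set J := p.contentIdeal
  have hmul : P * J ^ d * (p * q).contentIdeal ≤ J ^ (d + 1) * (p * q).contentIdeal := by
    rw [pow_succ']
    gcongr
  calc P * (q.erase e).contentIdeal * J ^ (d + 1)
      = P * (J ^ (d + 1) * (q.erase e).contentIdeal) := by ring
    _ ≤ P * (J ^ d * ((p * q).contentIdeal ⊔ J * Ideal.span {q.coeff e})) :=
      Ideal.mul_mono_right <| herase.trans <|
        Ideal.mul_mono_right (contentIdeal_mul_erase_le p q e)
    _ = P * J ^ d * (p * q).contentIdeal ⊔ P * Ideal.span {q.coeff e} * J ^ (d + 1) := by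
      simp only [← Ideal.add_eq_sup]
      ring
    _ ≤ J ^ (d + 1) * (p * q).contentIdeal := sup_le hmul hlead

/-- The **Dedekind–Mertens lemma**. -/
theorem contentIdeal_pow_succ_mul_le (p : R[X]) {d : ℕ} {q : R[X]} (hq : q.natDegree ≤ d) :
    p.contentIdeal ^ (d + 1) * q.contentIdeal ≤
      p.contentIdeal ^ d * (p * q).contentIdeal := by
  induction d generalizing q with
  | zero =>
    rw [zero_add, pow_one, pow_zero, one_mul]
    refine contentIdeal_mul_contentIdeal_le_of_natDegree_le hq le_rfl fun i hi l => ?_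
    rcases Nat.eq_zero_or_pos l with rfl | hl
    · exact hi
    · rw [coeff_eq_zero_of_natDegree_lt (hq.trans_lt hl), mul_zero]
      exact zero_mem _
  | succ d ih =>
    set J := p.contentIdeal
    set U := J ^ (d + 1) * (p * q).contentIdeal
    let T : Ideal R := U.colon (J ^ (d + 1) : Ideal R)
    have hT : ∀ K : Ideal R, K ≤ T ↔ K * J ^ (d + 1) ≤ U := fun K =>
      (forall₂_congr fun _ _ => Submodule.mem_colon).trans Ideal.mul_le.symm
    suffices h : J * q.contentIdeal ≤ T by
      rwa [hT, mul_right_comm, ← pow_succ'] at h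
    refine contentIdeal_mul_contentIdeal_le_of_natDegree_le hq ?_ fun i hi l => ?_
    · rw [hT, mul_comm]
    rcases eq_or_ne l (d + 1) with rfl | hl
    · exact hi
    rw [← Ideal.span_singleton_le_iff_mem, hT, ← Ideal.span_singleton_mul_span_singleton] at hi
    have hle : Ideal.span {p.coeff i} * (q.erase (d + 1)).contentIdeal ≤ T :=
      (hT _).mpr <| mul_contentIdeal_erase_mul_pow_le
        ((Ideal.span_singleton_le_iff_mem _).mpr (p.coeff_mem_contentIdeal i))
        (ih (natDegree_erase_succ_le hq)) hi
    rw [← erase_ne _ hl]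
    exact hle (Ideal.mul_mem_mul (Ideal.mem_span_singleton_self _) (coeff_mem_contentIdeal _ l))

end DedekindMertens

section GenericElement

open IsLocalRing Polynomial

variable {R : Type*} [CommRing R]

/-- The leading form of a generic element of `I` is regular on the associated graded ring of `I` in
large degrees. -/
theorem exists_forall_contentIdeal_le_pow [IsNoetherianRing R] {x : R[X]} {c : R}
    (hcx : c ∈ x.contentIdeal) (hc : IsRegular c) :
    ∃ k, ∀ n ≥ k, ∀ w : R[X], (x * w).contentIdeal ≤ x.contentIdeal ^ (n + 1) →
      w.contentIdeal ≤ x.contentIdeal ^ n := by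
  obtain ⟨k, hk⟩ := exists_forall_le_pow_of_pow_mul_le_pow_add hcx hc
  refine ⟨k, fun n hn w hw => hk n hn (w.natDegree + 1) _ ?_⟩
  calc x.contentIdeal ^ (w.natDegree + 1) * w.contentIdeal
      ≤ x.contentIdeal ^ w.natDegree * (x * w).contentIdeal :=
        contentIdeal_pow_succ_mul_le x le_rfl
    _ ≤ x.contentIdeal ^ w.natDegree * x.contentIdeal ^ (n + 1) := Ideal.mul_mono_right hw
    _ = x.contentIdeal ^ (n + (w.natDegree + 1)) := by ring

theorem contentIdeal_sum_mul_C_le {ι : Type*} [Fintype ι] {I J : Ideal R} {p : ι → R[X]}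
    (hp : ∀ i, (p i).contentIdeal ≤ J) (v : ι → I) :
    (∑ i, p i * C (v i : R)).contentIdeal ≤ J * I := by
  rw [contentIdeal_le_iff]
  intro l
  rw [finsetSum_coeff]
  refine Ideal.sum_mem _ fun i _ => ?_
  rw [coeff_mul_C]
  exact Ideal.mul_mem_mul (contentIdeal_le_iff.mp (hp i) l) (v i).2

theorem exists_sum_mul_C_eq {ι : Type*} [Fintype ι] {I : Ideal R} {v : ι → I}
    (hv : Submodule.span R (Set.range v) = ⊤) {p : R[X]} (hp : p.contentIdeal ≤ I) :
    ∃ a : ι → R[X], ∑ i, a i * C (v i : R) = p := by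
  have hI : Ideal.span (Set.range fun i => (v i : R)) = I := by
    have h := congrArg (Submodule.map I.subtype) hv
    rwa [Submodule.map_span, ← Set.range_comp, Submodule.map_top, Submodule.range_subtype] at h
  have hpI : p ∈ I.map C := Ideal.mem_map_C_iff.mpr (contentIdeal_le_iff.mp hp)
  rwa [← hI, Ideal.map_span, ← Set.range_comp, Ideal.mem_span_range_iff_exists_fun] at hpI

theorem det_mul_mem_of_mulVec_mem {ι : Type*} [Fintype ι] [DecidableEq ι] {J : Ideal R}
    {P : Matrix ι ι R} {v : ι → R} (h : ∀ i, P.mulVec v i ∈ J) (i : ι) : P.det * v i ∈ J := by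
  have hadj := congrFun (Matrix.mulVec_mulVec v P.adjugate P) i
  rw [Matrix.adjugate_mul, Matrix.smul_mulVec, Matrix.one_mulVec, Pi.smul_apply,
    smul_eq_mul] at hadj
  rw [← hadj]
  exact Ideal.sum_mem _ fun j _ => Ideal.mul_mem_left _ _ (h j)

theorem adjoinRoot_mk_mem_map_contentIdeal (f x : R[X]) :
    AdjoinRoot.mk f x ∈ x.contentIdeal.map (algebraMap R (AdjoinRoot f)) := by
  have h := Ideal.mem_map_of_mem (AdjoinRoot.mk f) <|
    Ideal.mem_map_C_iff.mpr (contentIdeal_le_iff.mp (le_refl x.contentIdeal))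
  rwa [Ideal.map_map] at h

variable [IsLocalRing R]

theorem map_residue_eq_zero_iff {p : R[X]} :
    p.map (residue R) = 0 ↔ p.contentIdeal ≤ maximalIdeal R := by
  simp only [Polynomial.ext_iff, coeff_map, coeff_zero, residue_eq_zero_iff,
    contentIdeal_le_iff]

/-- The matrix of multiplication by `x` from `I[X]` to `I'[X]`, with respect to minimal systems of
generators. -/
theorem exists_matrix_mulVec_eq [IsNoetherianRing R] {I I' : Ideal R} {x : R[X]}
    (hxI : x.contentIdeal * I ≤ I')
    (hx : ∀ w : R[X], (x * w).contentIdeal ≤ maximalIdeal R * I' →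
      w.contentIdeal ≤ maximalIdeal R * I) :
    ∃ (P : Matrix (Fin (minGenerators R I)) (Fin (minGenerators R I')) R[X])
      (u : Fin (minGenerators R I) → I) (v : Fin (minGenerators R I') → I'),
      Function.Injective
        (Matrix.vecMulLinear (P.map (mapRingHom (residue R)))) ∧
      Submodule.span R (Set.range v) = ⊤ ∧
      P.mulVec (fun i => C (v i : R)) = fun j => x * C (u j : R) := by
  obtain ⟨u, -, hu⟩ := exists_minimal_generators (R := R) (M := I)
  obtain ⟨v, hv, -⟩ := exists_minimal_generators (R := R) (M := I')
  have hxu : ∀ j, (x * C (u j : R)).contentIdeal ≤ I' := fun j =>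
    (contentIdeal_mul_le_mul_contentIdeal _ _).trans <| hxI.trans' <| Ideal.mul_mono_right <| by
      rw [contentIdeal_C, Ideal.span_singleton_le_iff_mem]
      exact (u j).2
  choose P hP using fun j => exists_sum_mul_C_eq hv (hxu j)
  refine ⟨Matrix.of P, u, v, ?_, hv, funext hP⟩
  rw [injective_iff_map_eq_zero]
  intro z hz
  obtain ⟨w, rfl⟩ := (map_surjective _ residue_surjective).comp_left z
  have hwP : ∀ i, (∑ j, w j * P j i).contentIdeal ≤ maximalIdeal R := by
    intro i
    rw [← map_residue_eq_zero_iff, Polynomial.map_sum]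
    simp only [Polynomial.map_mul]
    exact congrFun hz i
  have hsum : x * ∑ j, w j * C (u j : R) = ∑ i, (∑ j, w j * P j i) * C (v i : R) := by
    simp only [Finset.mul_sum, Finset.sum_mul]
    rw [Finset.sum_comm]
    refine Finset.sum_congr rfl fun j _ => ?_
    rw [mul_left_comm, ← hP j, Finset.mul_sum]
    exact Finset.sum_congr rfl fun i _ => (mul_assoc _ _ _).symm
  have hcontent := hx _ (hsum ▸ contentIdeal_sum_mul_C_le hwP v)
  refine funext fun j => map_residue_eq_zero_iff.mpr (contentIdeal_le_iff.mpr fun l => ?_)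
  refine hu (fun j => (w j).coeff l) ?_ j
  rw [Submodule.mem_smul_top_iff]
  simpa only [AddSubmonoidClass.coe_finsetSum, Submodule.coe_smul, smul_eq_mul, finsetSum_coeff,
    coeff_mul_C] using contentIdeal_le_iff.mp hcontent l

theorem minGenerators_le_of_forall_contentIdeal_le [IsNoetherianRing R] {I I' : Ideal R} {x : R[X]}
    (hxI : x.contentIdeal * I ≤ I')
    (hx : ∀ w : R[X], (x * w).contentIdeal ≤ maximalIdeal R * I' →
      w.contentIdeal ≤ maximalIdeal R * I) :
    minGenerators R I ≤ minGenerators R I' := by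
  obtain ⟨P, -, -, hP, -⟩ := exists_matrix_mulVec_eq hxI hx
  exact le_of_fin_injective _ _ hP

theorem exists_map_residue_ne_zero_and_span_mul_le [IsNoetherianRing R] {I I' : Ideal R}
    {x : R[X]} (hxI : x.contentIdeal * I ≤ I')
    (hx : ∀ w : R[X], (x * w).contentIdeal ≤ maximalIdeal R * I' →
      w.contentIdeal ≤ maximalIdeal R * I)
    (heq : minGenerators R I = minGenerators R I') :
    ∃ s : R[X], s.map (residue R) ≠ 0 ∧
      Ideal.span {s} * I'.map C ≤ Ideal.span {x} * I.map C := by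
  obtain ⟨P, u, v, hP, hv, hPv⟩ := exists_matrix_mulVec_eq hxI hx
  generalize minGenerators R I = e at *
  subst heq
  refine ⟨P.det, fun hdet => ?_, ?_⟩
  · rw [← coe_mapRingHom, RingHom.map_det] at hdet
    obtain ⟨z, hz, hz0⟩ := Matrix.exists_vecMul_eq_zero_iff.mpr hdet
    exact hz (hP (hz0.trans (map_zero _).symm))
  · have hmem : ∀ j, P.mulVec (fun i => C (v i : R)) j ∈ Ideal.span {x} * I.map C := fun j => by
      rw [hPv]
      exact Ideal.mul_mem_mul (Ideal.mem_span_singleton_self x) (Ideal.mem_map_of_mem C (u j).2)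
    rw [Ideal.span_singleton_mul_le_iff]
    intro p hp
    obtain ⟨a, rfl⟩ := exists_sum_mul_C_eq hv (contentIdeal_le_iff.mpr (Ideal.mem_map_C_iff.mp hp))
    rw [Finset.mul_sum]
    refine Ideal.sum_mem _ fun i _ => ?_
    rw [mul_left_comm]
    exact Ideal.mul_mem_left _ _ (det_mul_mem_of_mulVec_mem hmem i)

theorem isUnit_of_mul_sub_one_mem_map_maximalIdeal {A : Type*} [CommRing A] [Algebra R A]
    [Algebra.IsIntegral R A] {a b : A}
    (h : a * b - 1 ∈ (maximalIdeal R).map (algebraMap R A)) : IsUnit a := by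
  by_contra ha
  obtain ⟨Q, hQ, haQ⟩ := exists_max_ideal_of_mem_nonunits ha
  have hcomap := eq_maximalIdeal
    (Ideal.isMaximal_comap_of_isIntegral_of_isMaximal (R := R) Q)
  have hle := Ideal.map_le_iff_le_comap.mpr hcomap.ge
  refine hQ.ne_top ((Ideal.eq_top_iff_one Q).mpr ?_)
  exact sub_sub_cancel (a * b) 1 ▸ Q.sub_mem (Ideal.mul_mem_right b Q haQ) (hle h)

/-- The polynomial `f` is a monic lift of a scalar multiple of `s * X + 1`. -/
theorem exists_monic_isUnit_mk {s : R[X]} (hs : s.map (residue R) ≠ 0) :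
    ∃ f : R[X], f.Monic ∧ ¬ IsUnit f ∧ IsUnit (AdjoinRoot.mk f s) := by
  set g := s.map (residue R) * X + 1 with hg
  have hdeg : 0 < g.natDegree := by
    rw [hg, ← C_1, natDegree_add_C, natDegree_mul_X hs]
    exact Nat.succ_pos _
  have hg0 : g ≠ 0 := ne_zero_of_natDegree_gt hdeg
  obtain ⟨a, ha⟩ := residue_surjective g.leadingCoeff
  have hlift : g * C g.leadingCoeff⁻¹ ∈ lifts (residue R) :=
    (lifts_iff_coeff_lifts _).mpr fun n => residue_surjective _
  obtain ⟨f, hfg, hfdeg, hf⟩ :=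
    lifts_and_natDegree_eq_and_monic hlift (monic_mul_leadingCoeff_inv hg0)
  have hcong : (s * X + 1 - C a * f).map (residue R) = 0 := by
    rw [Polynomial.map_sub, Polynomial.map_mul, Polynomial.map_add, Polynomial.map_mul, map_X,
      Polynomial.map_one, ← hg, map_C, ha, hfg, mul_left_comm, ← C_mul,
      mul_inv_cancel₀ (leadingCoeff_ne_zero.mpr hg0), C_1, mul_one, sub_self]
  refine ⟨f, hf, ?_, ?_⟩
  · rw [hf.isUnit_iff, ← hf.natDegree_eq_zero, hfdeg,
      natDegree_mul_leadingCoeff_inv g hg0]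
    exact hdeg.ne'
  have := hf.finite_adjoinRoot
  refine isUnit_of_mul_sub_one_mem_map_maximalIdeal (R := R) (b := -AdjoinRoot.mk f X) ?_
  have hsub : AdjoinRoot.mk f s * -AdjoinRoot.mk f X - 1 =
      -AdjoinRoot.mk f (s * X + 1 - C a * f) := by
    simp only [map_sub, map_add, map_mul, map_one, AdjoinRoot.mk_self]
    ring
  rw [hsub]
  exact neg_mem <| Ideal.map_mono (map_residue_eq_zero_iff.mp hcong) <|
    adjoinRoot_mk_mem_map_contentIdeal f _

/-- Passing to `AdjoinRoot f` replaces the usual enlargement of the residue field to an infinite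
one. -/
theorem exists_monic_span_mk_mul_map_eq [IsNoetherianRing R] {I I' : Ideal R} {x : R[X]}
    (hxI : x.contentIdeal * I = I')
    (hx : ∀ w : R[X], (x * w).contentIdeal ≤ maximalIdeal R * I' →
      w.contentIdeal ≤ maximalIdeal R * I)
    (heq : minGenerators R I = minGenerators R I') :
    ∃ f : R[X], f.Monic ∧ ¬ IsUnit f ∧
      Ideal.span {AdjoinRoot.mk f x} * I.map (algebraMap R (AdjoinRoot f)) =
        I'.map (algebraMap R (AdjoinRoot f)) := by
  obtain ⟨s, hs, hsx⟩ := exists_map_residue_ne_zero_and_span_mul_le hxI.le hx heq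
  obtain ⟨f, hf, hfunit, hsunit⟩ := exists_monic_isUnit_mk hs
  refine ⟨f, hf, hfunit, le_antisymm ?_ ?_⟩
  · rw [← hxI, Ideal.map_mul]
    exact Ideal.mul_mono_left <|
      (Ideal.span_singleton_le_iff_mem _).mpr (adjoinRoot_mk_mem_map_contentIdeal f x)
  · have h := Ideal.map_mono (f := AdjoinRoot.mk f) hsx
    rwa [Ideal.map_mul, Ideal.map_mul, Ideal.map_span, Ideal.map_span, Set.image_singleton,
      Set.image_singleton, Ideal.span_singleton_eq_top.mpr hsunit, Ideal.top_mul, Ideal.map_map,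
      Ideal.map_map] at h

end GenericElement

section Sequences

theorem le_of_tendsto_div_of_add_le {a : ℕ → ℝ} {c e : ℝ} {N : ℕ}
    (ha : ∀ n ≥ N, a n + c ≤ a (n + 1)) (h : Tendsto (fun n : ℕ => a n / n) atTop (𝓝 e)) :
    c ≤ e := by
  have hlinear : ∀ n ≥ N, a N - c * N + n * c ≤ a n := by
    intro n hn
    induction n, hn using Nat.le_induction with
    | base => linarith
    | succ n hn ih =>
      push_cast
      linarith [ha n hn]
  have hlim : Tendsto (fun n : ℕ => (a N - c * N) / n + c) atTop (𝓝 (0 + c)) :=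
    (tendsto_const_div_atTop_nhds_zero_nat _).add_const c
  rw [zero_add] at hlim
  refine le_of_tendsto_of_tendsto hlim h ?_
  filter_upwards [eventually_ge_atTop N, eventually_gt_atTop 0] with n hn hpos
  rw [div_add' _ _ _ (Nat.cast_ne_zero.mpr hpos.ne'), mul_comm c (n : ℝ)]
  exact div_le_div_of_nonneg_right (hlinear n hn) n.cast_nonneg

theorem exists_eq_of_tendsto_div {h μ : ℕ → ℕ} {k e : ℕ} (hμ : ∀ n, h (n + 1) = h n + μ n)
    (hmono : ∀ n ≥ k, μ n ≤ μ (n + 1))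
    (hlim : Tendsto (fun n : ℕ => (h n : ℝ) / n) atTop (𝓝 (e : ℝ))) :
    ∃ n ≥ k, μ n = e ∧ μ (n + 1) = e := by
  have hsucc : ∀ n, (h (n + 1) : ℝ) = h n + μ n := fun n => mod_cast hμ n
  have hle : ∀ n ≥ k, μ n ≤ e := by
    intro n hn
    suffices (μ n : ℝ) ≤ e from mod_cast this
    refine le_of_tendsto_div_of_add_le (a := fun l => (h l : ℝ)) (N := n) (fun l hl => ?_) hlim
    have hnl : μ n ≤ μ l := monotoneOn_nat_Ici_of_le_succ hmono hn (hn.trans hl) hl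
    rw [hsucc]
    gcongr
  obtain ⟨n, hn, hne⟩ : ∃ n ≥ k, e ≤ μ n := by
    by_contra! hlt
    have hcontra : (1 - e : ℝ) ≤ -e := by
      refine le_of_tendsto_div_of_add_le (a := fun l => -(h l : ℝ)) (N := k) (fun l hl => ?_) ?_
      · have hl' : (μ l : ℝ) + 1 ≤ e := mod_cast hlt l hl
        rw [hsucc]
        linarith
      · simpa only [neg_div] using hlim.neg
    linarith
  have hn_eq : μ n = e := le_antisymm (hle n hn) hne
  exact ⟨n, hn, hn_eq, le_antisymm (hle _ (by omega)) (hn_eq ▸ hmono n hn)⟩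

end Sequences

section MinimalMultiplicity

open IsLocalRing

variable {R : Type*} [CommRing R]

theorem length_quotient_map_algebraMap {A : Type*} [CommRing A] [Algebra R A] [Nontrivial R]
    [Module.Free R A] [Module.Finite R A] (I : Ideal R) :
    Module.length R (A ⧸ I.map (algebraMap R A)) =
      Module.finrank R A * Module.length R (R ⧸ I) := by
  have e₁ : (A ⧸ I.map (algebraMap R A)) ≃ₗ[R] A ⧸ (I • (⊤ : Submodule R A)) :=
    (Submodule.Quotient.restrictScalarsEquiv R (I.map (algebraMap R A))).symm.trans
      (Submodule.quotEquivOfEq _ _ (Ideal.smul_top_eq_map I).symm)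
  have e₂ : (A ⧸ (I • (⊤ : Submodule R A))) ≃ₗ[R] (R ⧸ I) ⊗[R] (Fin (Module.finrank R A) → R) :=
    (TensorProduct.quotTensorEquivQuotSMul A I).symm.trans
      (TensorProduct.congr (LinearEquiv.refl R _) (Module.finBasis R A).equivFun)
  rw [((e₁.trans e₂).trans (TensorProduct.piScalarRight R R _ _)).length_eq, Module.length_pi,
    ENat.card_eq_coe_fintype_card, Fintype.card_fin]

theorem length_quotient_span_singleton_mul {A : Type*} [CommRing A] [Algebra R A] {x : A}
    (hx : Function.Injective (LinearMap.mulLeft R x)) (J : Ideal A) :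
    Module.length R (A ⧸ Ideal.span {x} * J) =
      Module.length R (A ⧸ J) + Module.length R (A ⧸ Ideal.span {x}) := by
  have h := cokerLength_comp (J.restrictScalars R).subtype (LinearMap.mulLeft R x) hx
  have hxJ : LinearMap.range (LinearMap.mulLeft R x ∘ₗ (J.restrictScalars R).subtype) =
      (Ideal.span {x} * J).restrictScalars R := by
    ext y
    rw [Submodule.restrictScalars_mem, Ideal.mem_span_singleton_mul]
    exact ⟨fun ⟨z, hz⟩ => ⟨z, z.2, hz⟩, fun ⟨z, hz, hzy⟩ => ⟨⟨z, hz⟩, hzy⟩⟩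
  have hxA : LinearMap.range (LinearMap.mulLeft R x) = (Ideal.span {x}).restrictScalars R := by
    ext y
    rw [Submodule.restrictScalars_mem, Ideal.mem_span_singleton]
    exact ⟨fun ⟨z, hz⟩ => ⟨z, hz.symm⟩, fun ⟨z, hz⟩ => ⟨z, hz.symm⟩⟩
  simp only [cokerLength] at h
  rwa [hxJ, hxA, Submodule.range_subtype,
    (Submodule.Quotient.restrictScalarsEquiv R _).length_eq,
    (Submodule.Quotient.restrictScalarsEquiv R _).length_eq,
    (Submodule.Quotient.restrictScalarsEquiv R _).length_eq] at h

theorem eq_of_le_of_length_quotient_eq {N : Type*} [AddCommGroup N] [Module R N]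
    {P Q : Submodule R N} (hle : P ≤ Q) (hfin : Module.length R (N ⧸ Q) ≠ ⊤)
    (h : Module.length R (N ⧸ P) = Module.length R (N ⧸ Q)) : P = Q := by
  have hQ : cokerLength Q.subtype = Module.length R (N ⧸ Q) := by
    rw [cokerLength, Submodule.range_subtype]
  have hsum := cokerLength_comp (Submodule.inclusion hle) Q.subtype Q.subtype_injective
  rw [Submodule.subtype_comp_inclusion, hQ, cokerLength, Submodule.range_subtype,
    h] at hsum
  have hzero : cokerLength (Submodule.inclusion hle) = 0 :=
    (ENat.add_left_injective_of_ne_top hfin ((zero_add _).trans hsum)).symm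
  rw [cokerLength_eq_zero_iff] at hzero
  refine le_antisymm hle fun y hy => ?_
  obtain ⟨z, hz⟩ := hzero ⟨y, hy⟩
  have hzy : (z : N) = y := congrArg Subtype.val hz
  exact hzy ▸ z.2

variable [IsNoetherianRing R] [IsLocalRing R]

theorem HasMinimalMultiplicity.tendsto (hdim : ringKrullDim R = 1)
    (h : HasMinimalMultiplicity R) :
    Tendsto (fun n : ℕ => (hilbertSamuel R n : ℝ) / n) atTop
      (𝓝 (minGenerators R (maximalIdeal R) : ℝ)) := by
  obtain ⟨d, e, hd, ⟨d', hd', hlim⟩, he⟩ := h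
  obtain rfl : d = 1 := mod_cast hd.symm.trans hdim
  obtain rfl : d' = 1 := mod_cast hd'.symm.trans hdim
  obtain rfl : e = embDim R := by omega
  rw [← embDim_eq_minGenerators]
  simpa only [Nat.factorial_one, Nat.cast_one, one_mul, pow_one] using hlim

variable [Ring.KrullDimLE 1 R] {c : R}

theorem length_quotient_pow_ne_top (hcm : c ∈ maximalIdeal R) (hc : IsRegular c)
    (n : ℕ) : Module.length R (R ⧸ maximalIdeal R ^ n) ≠ ⊤ := by
  refine length_ne_top_of_smul_eq_zero (hc.pow n) fun y => ?_
  obtain ⟨y, rfl⟩ := Submodule.Quotient.mk_surjective _ y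
  rw [← Submodule.Quotient.mk_smul, Submodule.Quotient.mk_eq_zero]
  exact Ideal.mul_mem_right _ _ (Ideal.pow_mem_pow hcm n)

theorem hilbertSamuel_succ (hcm : c ∈ maximalIdeal R) (hc : IsRegular c) (n : ℕ) :
    hilbertSamuel R (n + 1) =
      hilbertSamuel R n + minGenerators R ↥(maximalIdeal R ^ n) := by
  rw [hilbertSamuel, pow_succ', length_quotient_maximalIdeal_mul,
    ENat.toNat_add (length_quotient_pow_ne_top hcm hc n) (ENat.natCast_ne_top _),
    ENat.toNat_natCast, hilbertSamuel]

/-- Both `x 𝔪ⁿ = 𝔪ⁿ⁺¹` and `x 𝔪 = 𝔪²` say that `A / x` has length `rank A` times the minimal number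
of generators of `𝔪`. -/
theorem span_singleton_mul_map_eq_of_minGenerators_pow_eq {A : Type*} [CommRing A] [Algebra R A]
    [Module.Free R A] [Module.Finite R A] (hcm : c ∈ maximalIdeal R)
    (hc : IsRegular c) {x : A} (hxm : x ∈ (maximalIdeal R).map (algebraMap R A)) {n : ℕ}
    (hxn : Ideal.span {x} * (maximalIdeal R ^ n).map (algebraMap R A) =
      (maximalIdeal R ^ (n + 1)).map (algebraMap R A))
    (h : minGenerators R ↥(maximalIdeal R ^ n) =
      minGenerators R (maximalIdeal R)) :
    Ideal.span {x} * (maximalIdeal R).map (algebraMap R A) =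
      (maximalIdeal R ^ 2).map (algebraMap R A) := by
  set 𝔪 := maximalIdeal R
  have hinj : Function.Injective (LinearMap.mulLeft R x) := by
    obtain ⟨z, hz⟩ := exists_mulLeft_comp_mulLeft_eq_smul <|
      (hxn.ge.trans Ideal.mul_le_left) (Ideal.mem_map_of_mem _ (Ideal.pow_mem_pow hcm (n + 1)))
    exact injective_of_comp_eq_smul (hc.pow _) hz
  have hfin : ∀ k, Module.length R (A ⧸ (𝔪 ^ k).map (algebraMap R A)) ≠ ⊤ := fun k => by
    rw [length_quotient_map_algebraMap]
    exact WithTop.mul_ne_top (ENat.natCast_ne_top _) (length_quotient_pow_ne_top hcm hc k)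
  have hlength : Module.length R (A ⧸ Ideal.span {x}) =
      Module.finrank R A * (minGenerators R 𝔪 : ℕ∞) := by
    refine ENat.add_right_injective_of_ne_top (hfin n) ?_
    beta_reduce
    rw [← length_quotient_span_singleton_mul hinj, hxn, length_quotient_map_algebraMap,
      length_quotient_map_algebraMap, pow_succ', length_quotient_maximalIdeal_mul, h, mul_add]
  have hle : Ideal.span {x} * 𝔪.map (algebraMap R A) ≤ (𝔪 ^ 2).map (algebraMap R A) := by
    rw [pow_two, Ideal.map_mul]
    exact Ideal.mul_mono_left ((Ideal.span_singleton_le_iff_mem _).mpr hxm)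
  refine Submodule.restrictScalars_injective R A A (eq_of_le_of_length_quotient_eq hle ?_ ?_)
  · rw [(Submodule.Quotient.restrictScalarsEquiv R _).length_eq]
    exact hfin 2
  · rw [(Submodule.Quotient.restrictScalarsEquiv R _).length_eq,
      (Submodule.Quotient.restrictScalarsEquiv R _).length_eq,
      length_quotient_span_singleton_mul hinj, hlength, length_quotient_map_algebraMap,
      length_quotient_map_algebraMap, pow_two, length_quotient_maximalIdeal_mul, mul_add]

open Polynomial in
theorem HasMinimalMultiplicity.exists_monic_span_mul_map_eq (hdim : ringKrullDim R = 1)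
    (hmin : HasMinimalMultiplicity R) (hcm : c ∈ maximalIdeal R) (hc : IsRegular c) :
    ∃ f : R[X], f.Monic ∧ ¬ IsUnit f ∧ ∃ x : AdjoinRoot f,
      Ideal.span {x} * (maximalIdeal R).map (algebraMap R (AdjoinRoot f)) =
        (maximalIdeal R ^ 2).map (algebraMap R (AdjoinRoot f)) := by
  obtain ⟨x, hx⟩ := exists_contentIdeal_eq (IsNoetherian.noetherian (maximalIdeal R))
  obtain ⟨k, hk⟩ := exists_forall_contentIdeal_le_pow (hx.symm ▸ hcm) hc
  have hmul : ∀ n, x.contentIdeal * maximalIdeal R ^ n =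
      maximalIdeal R ^ (n + 1) := fun n => by rw [hx, pow_succ']
  have hregular : ∀ n ≥ k, ∀ w : R[X],
      (x * w).contentIdeal ≤ maximalIdeal R * maximalIdeal R ^ (n + 1) →
      w.contentIdeal ≤ maximalIdeal R * maximalIdeal R ^ n := by
    intro n hn w
    simpa only [← pow_succ', hx] using hk (n + 1) (by omega) w
  obtain ⟨n, hn, hn_eq, hn_succ_eq⟩ := exists_eq_of_tendsto_div (hilbertSamuel_succ hcm hc)
    (fun n hn => minGenerators_le_of_forall_contentIdeal_le (hmul n).le (hregular n hn))
    (hmin.tendsto hdim)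
  obtain ⟨f, hf, hunit, hfx⟩ :=
    exists_monic_span_mk_mul_map_eq (hmul n) (hregular n hn) (hn_eq.trans hn_succ_eq.symm)
  have := hf.free_adjoinRoot
  have := hf.finite_adjoinRoot
  exact ⟨f, hf, hunit, AdjoinRoot.mk f x, span_singleton_mul_map_eq_of_minGenerators_pow_eq hcm hc
    (hx ▸ adjoinRoot_mk_mem_map_contentIdeal f x) hfx hn_eq⟩

theorem HasModuleRank.free_of_hasMinimalMultiplicity {M : Type*} [AddCommGroup M] [Module R M]
    [Module.Finite R M] [Module.IsTorsionFree R (M ⊗[R] Module.Dual R M)] {r : ℕ}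
    (hM : HasModuleRank R M r) (hr : 0 < r ∨ Subsingleton M) (hdim : ringKrullDim R = 1)
    (hmin : HasMinimalMultiplicity R) (hcm : c ∈ maximalIdeal R) (hc : IsRegular c) :
    Module.Free R M := by
  obtain ⟨f, hf, hunit, x, hx⟩ := hmin.exists_monic_span_mul_map_eq hdim hcm hc
  have := hf.free_adjoinRoot
  have := hf.finite_adjoinRoot
  have : Nontrivial (AdjoinRoot f) :=
    Ideal.Quotient.nontrivial_iff.mpr (mt Ideal.span_singleton_eq_top.mp hunit)
  exact hM.free_of_span_singleton_mul_map_eq hr hx hcm hc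

end MinimalMultiplicity

theorem corollary3p5 {R : Type*} [CommRing R] [IsNoetherianRing R] [IsLocalRing R]
    (hdim : ringKrullDim R = 1)
    {M : Type*} [AddCommGroup M] [Module R M] [Module.Finite R M]
    (r : ℕ) (hrank : HasModuleRank R M r) (hr : 0 < r ∨ Subsingleton M)
    (htf : Module.IsTorsionFree R (M ⊗[R] Module.Dual R M)) :
    ((∃ (x : R) (n : ℕ), traceIdeal R M ≤ IsLocalRing.maximalIdeal R ^ n ∧
        Ideal.span {x} * IsLocalRing.maximalIdeal R ^ n =
          IsLocalRing.maximalIdeal R ^ (n + 1)) → Module.Free R M) ∧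
      (HasMinimalMultiplicity R → Module.Free R M) := by
  have : Ring.KrullDimLE 1 R := Ring.krullDimLE_iff.mpr hdim.le
  by_cases hreg : ∃ c ∈ IsLocalRing.maximalIdeal R, IsRegular c
  · obtain ⟨c, hcm, hc⟩ := hreg
    refine ⟨?_, fun hmin => hrank.free_of_hasMinimalMultiplicity hr hdim hmin hcm hc⟩
    rintro ⟨x, n, htr, hx⟩
    rcases hr with hr | hr
    · exact hrank.genericallyFree.free_of_traceIdeal_le_pow (A := R) hr htr
        (by simpa only [Algebra.algebraMap_self, Ideal.map_id] using hx) hcm hc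
    · exact Module.Free.of_subsingleton R M
  · have hfree : Module.Free R M := hrank.genericallyFree.free_of_forall_isUnit fun c hc =>
      not_not.mp fun hcu => hreg ⟨c, hcu, hc⟩
    exact ⟨fun _ => hfree, fun _ => hfree⟩
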